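/- Conventions. Let $A$ be a C*-algebra (complex, not necessarily unital) with multiplier algebra $M(A)$. A linear operator $T$ acting on $A$ with dense domain $D(T)\subset A$ is said to be \emph{affiliated} with $A$, written $T\,\eta\,A$, if there is $z\in M(A)$ with $\|z\|\le 1$ such that for all $x,y\in A$: \[ x\in D(T)\ \text{and}\ y=Tx \iff \text{there is } a\in A \text{ with } x=(1-z^*z)^{1/2}a \text{ and } y=za . \] This $z$ is determined by $T$; it is called the $z$-transform of $T$ and denoted $z_T$. Two elements $T_1,T_2\,\eta\,A$ with $z$-transforms $z_1,z_2$ are said to \emph{strongly commute} if $z_1z_2=z_2z_1$ and $z_1^*z_2=z_2z_1^*$. Theorem. Let $A$ be a C*-algebra and let $T_1,T_2\,\eta\,A$ be a strongly commuting pair of affiliated elements. Let $D(T_0)=\{a\in D(T_2): T_2a\in D(T_1)\}$ and define $T_0:D(T_0)\to A$ by $T_0a=T_1(T_2a)$. Then $T_0$ is a closable operator acting on the Banach space $A$, and its closure is affiliated with $A$. Denote this closure by $T_1T_2$. The composite in the other order, $a\mapsto T_2(T_1a)$ on $\{a\in D(T_1): T_1a\in D(T_2)\}$, is closable too, and its closure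 $T_2T_1$ satisfies $T_1T_2=T_2T_1$. -/

import Mathlib

open scoped MultiplierAlgebra

noncomputable section

namespace CStarAffiliation

variable {A : Type*} [NonUnitalCStarAlgebra A]

/-- For a multiplier `z`, the multiplier `(1 - z^* z)^{1/2}` (continuous functional calculus in the
multiplier algebra `M(A)`). It is the positive square root of `1 - z^* z` whenever `‖z‖ ≤ 1`. -/
def cosMul (z : 𝓜(ℂ, A)) : 𝓜(ℂ, A) :=
  cfc Real.sqrt (1 - star z * z)

/-- `z ∈ M(A)` is a `z`-transform of the operator `T` acting on `A`: `‖z‖ ≤ 1`, and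
`x ∈ D(T)`, `y = T x` iff `x = (1 - z^* z)^{1/2} a` and `y = z a` for some `a ∈ A`.
A multiplier `m` acts on `a ∈ A` as `m.fst a`. -/
def IsZTransform (T : A →ₗ.[ℂ] A) (z : 𝓜(ℂ, A)) : Prop :=
  ‖z‖ ≤ 1 ∧
    ∀ x y : A, (∃ hx : x ∈ T.domain, T ⟨x, hx⟩ = y) ↔ ∃ a : A, x = (cosMul z).fst a ∧ y = z.fst a

/-- The affiliation relation `T η A` of Woronowicz: `T` is a densely defined linear operator
acting on `A` that has a `z`-transform in `M(A)`. -/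
def IsAffiliated (T : A →ₗ.[ℂ] A) : Prop :=
  Dense (T.domain : Set A) ∧ ∃ z : 𝓜(ℂ, A), IsZTransform T z

theorem cosMul_isSelfAdjoint (z : 𝓜(ℂ, A)) : star (cosMul z) = cosMul z :=
  IsSelfAdjoint.star_eq (cfc_predicate Real.sqrt (1 - star z * z))

theorem cosMul_mul_self (z : 𝓜(ℂ, A)) (hz : ‖z‖ ≤ 1) :
    cosMul z * cosMul z = 1 - star z * z := by
  let _ := CStarAlgebra.spectralOrder 𝓜(ℂ, A)
  have := CStarAlgebra.spectralOrderedRing 𝓜(ℂ, A)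
  have hsa : IsSelfAdjoint (1 - star z * z) :=
    (IsSelfAdjoint.one _).sub (IsSelfAdjoint.star_mul_self z)
  have hn : (0 : 𝓜(ℂ, A)) ≤ 1 - star z * z := by
    rw [sub_nonneg]
    refine (CStarAlgebra.norm_le_one_iff_of_nonneg _ (star_mul_self_nonneg z)).1 ?_
    rw [CStarRing.norm_star_mul_self]
    exact mul_le_one₀ hz (norm_nonneg z) hz
  unfold cosMul
  rw [← cfc_mul Real.sqrt Real.sqrt (1 - star z * z) (by fun_prop) (by fun_prop)]
  conv_rhs => rw [← cfc_id ℝ (1 - star z * z) hsa]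
  refine cfc_congr fun x hx => ?_
  exact Real.mul_self_sqrt (spectrum_nonneg_of_nonneg hn hx)

theorem star_fst_mul_fst (m n : 𝓜(ℂ, A)) (a b : A) :
    star (m.fst a) * n.fst b = star a * (star m * n).fst b := by
  have h : star (m.fst a) = (star m).snd (star a) := by simp
  rw [h, (star m).central]
  rfl

theorem inner_formula (z : 𝓜(ℂ, A)) (hz : ‖z‖ ≤ 1) (a b : A) :
    star ((cosMul z).fst a) * (cosMul z).fst b + star (z.fst a) * z.fst b = star a * b := by
  rw [star_fst_mul_fst, star_fst_mul_fst, cosMul_isSelfAdjoint, cosMul_mul_self z hz, ← mul_add]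
  congr 1
  rw [DoubleCentralizer.sub_fst]
  simp

/-- The `z`-transform of a densely defined operator is unique. -/
theorem zTransform_unique (T : A →ₗ.[ℂ] A) (hT : Dense (T.domain : Set A)) (z w : 𝓜(ℂ, A))
    (hz : IsZTransform T z) (hw : IsZTransform T w) : z = w := by
  have key : ∀ {z w : 𝓜(ℂ, A)}, IsZTransform T z → IsZTransform T w → ∀ a, ∃ b,
      (cosMul z).fst a = (cosMul w).fst b ∧ z.fst a = w.fst b := fun {z w} hz hw a =>
    (hw.2 _ _).1 ((hz.2 _ _).2 ⟨a, rfl, rfl⟩)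
  have hdef : ∀ x y : A, (∀ a : A, star a * x = star a * y) → x = y := by
    intro x y h
    have h0 : star (x - y) * (x - y) = 0 := by rw [mul_sub, h, sub_self]
    exact sub_eq_zero.1 ((CStarRing.star_mul_self_eq_zero_iff _).1 h0)
  have hinn : ∀ a b a' b', (cosMul z).fst a = (cosMul w).fst b → z.fst a = w.fst b →
      (cosMul z).fst a' = (cosMul w).fst b' → z.fst a' = w.fst b' →
      star a * a' = star b * b' := by
    intro a b a' b' h1 h2 h3 h4
    rw [← inner_formula z hz.1 a a', ← inner_formula w hw.1 b b', h1, h2, h3, h4]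
  have hcsym : ∀ (m : 𝓜(ℂ, A)) (a b : A),
      star ((cosMul m).fst a) * b = star a * (cosMul m).fst b := by
    intro m a b
    have := star_fst_mul_fst (cosMul m) 1 a b
    rw [cosMul_isSelfAdjoint, mul_one] at this
    simpa using! this
  have hsq : cosMul z * cosMul z = cosMul w * cosMul w := by
    have hf : ∀ y, (cosMul z).fst ((cosMul z).fst y) = (cosMul w).fst ((cosMul w).fst y) := by
      intro y
      obtain ⟨a', h3, h4⟩ := key hw hz ((cosMul w).fst y)
      have : (cosMul z).fst y = a' := by
        apply hdef
        intro a
        obtain ⟨b, h1, h2⟩ := key hz hw a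
        rw [hinn a b a' _ h1 h2 h3.symm h4.symm, ← hcsym, ← hcsym, h1]
      rw [this, h3]
    have h1 : (cosMul z * cosMul z).fst = (cosMul w * cosMul w).fst :=
      ContinuousLinearMap.ext hf
    rw [← sub_eq_zero, ← norm_eq_zero, ← DoubleCentralizer.norm_fst, DoubleCentralizer.sub_fst,
      h1, sub_self, norm_zero]
  have hc : cosMul z = cosMul w := by
    rw [cosMul_mul_self z hz.1, cosMul_mul_self w hw.1] at hsq
    unfold cosMul
    rw [hsq]
  have hfst : z.fst = w.fst := by
    ext a
    obtain ⟨b, h1, h2⟩ := key hz hw a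
    rw [hc] at h1
    have hdense : ∀ x ∈ T.domain, star (a - b) * x = 0 := by
      intro x hx
      obtain ⟨c, hxc, -⟩ := (hw.2 x (T ⟨x, hx⟩)).1 ⟨hx, rfl⟩
      rw [hxc, ← hcsym, map_sub, h1, sub_self, star_zero, zero_mul]
    have h0 : (fun x : A => star (a - b) * x) = fun _ => 0 :=
      Continuous.ext_on hT (by fun_prop) (by fun_prop) hdense
    have hab : a = b :=
      sub_eq_zero.1 ((CStarRing.star_mul_self_eq_zero_iff _).1 (congrFun h0 (a - b)))
    rw [h2, hab]
  rw [← sub_eq_zero, ← norm_eq_zero, ← DoubleCentralizer.norm_fst, DoubleCentralizer.sub_fst,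
    hfst, sub_self, norm_zero]

/-- The `z`-transform `z_T` of an affiliated element (it is unique, see `zTransform_unique`). -/
def zTransform (T : A →ₗ.[ℂ] A) (hT : IsAffiliated T) : 𝓜(ℂ, A) :=
  hT.2.choose

/-- Strong commutation of affiliated elements: `z₁ z₂ = z₂ z₁` and `z₁^* z₂ = z₂ z₁^*`. -/
def StronglyCommute (T₁ T₂ : A →ₗ.[ℂ] A) (h₁ : IsAffiliated T₁) (h₂ : IsAffiliated T₂) : Prop :=
  zTransform T₁ h₁ * zTransform T₂ h₂ = zTransform T₂ h₂ * zTransform T₁ h₁ ∧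
    star (zTransform T₁ h₁) * zTransform T₂ h₂ = zTransform T₂ h₂ * star (zTransform T₁ h₁)

/-- The composite `a ↦ T₁ (T₂ a)` on the maximal domain `{a ∈ D(T₂) | T₂ a ∈ D(T₁)}`. -/
def composite (T₁ T₂ : A →ₗ.[ℂ] A) : A →ₗ.[ℂ] A where
  domain :=
    { carrier := {a | ∃ ha : a ∈ T₂.domain, T₂ ⟨a, ha⟩ ∈ T₁.domain}
      zero_mem' := ⟨T₂.domain.zero_mem, by
        have : T₂ (0 : T₂.domain) ∈ T₁.domain := by rw [T₂.map_zero]; exact T₁.domain.zero_mem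
        exact this⟩
      add_mem' := by
        rintro a b ⟨ha, ha'⟩ ⟨hb, hb'⟩
        refine ⟨T₂.domain.add_mem ha hb, ?_⟩
        have h := T₁.domain.add_mem ha' hb'
        rw [← T₂.map_add] at h
        exact h
      smul_mem' := by
        rintro c a ⟨ha, ha'⟩
        refine ⟨T₂.domain.smul_mem c ha, ?_⟩
        have h := T₁.domain.smul_mem c ha'
        rw [← T₂.map_smul] at h
        exact h }
  toFun :=
    { toFun := fun a => T₁ ⟨T₂ ⟨a.1, a.2.1⟩, a.2.2⟩
      map_add' := by
        intro a b
        rw [← T₁.map_add]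
        congr 1
        apply Subtype.ext
        change T₂ _ = T₂ _ + T₂ _
        rw [← T₂.map_add]
        rfl
      map_smul' := by
        intro c a
        rw [RingHom.id_apply, ← T₁.map_smul]
        congr 1
        apply Subtype.ext
        change T₂ _ = c • T₂ _
        rw [← T₂.map_smul]
        rfl }

theorem zTransform_spec (T : A →ₗ.[ℂ] A) (hT : IsAffiliated T) :
    IsZTransform T (zTransform T hT) :=
  hT.2.choose_spec

theorem mem_domain_composite (T₁ T₂ : A →ₗ.[ℂ] A) (a : A) :
    a ∈ (composite T₁ T₂).domain ↔ ∃ ha : a ∈ T₂.domain, T₂ ⟨a, ha⟩ ∈ T₁.domain :=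
  Iff.rfl

theorem composite_apply (T₁ T₂ : A →ₗ.[ℂ] A) (a : A) (ha : a ∈ T₂.domain)
    (ha' : T₂ ⟨a, ha⟩ ∈ T₁.domain) :
    composite T₁ T₂ ⟨a, ⟨ha, ha'⟩⟩ = T₁ ⟨T₂ ⟨a, ha⟩, ha'⟩ :=
  rfl

end CStarAffiliation

end

open scoped MultiplierAlgebra

/-! Write `c = (1 - z^* z)^{1/2}` for each `z`-transform. Formally `T_i = z_i c_i⁻¹`, so strong
commutation suggests `T₁T₂ = (z₁z₂)(c₁c₂)⁻¹`. Normalizing by `k² = (z₁z₂)^*(z₁z₂) + (c₁c₂)²`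
suggests the transform `z = z₁z₂k⁻¹`, with `c_z = c₁c₂k⁻¹`.

In general `k` is not invertible, but its range is dense because `k² ≥ (c₁c₂)²`
(`denseRange_of_eq_add`). The map `k a ↦ z₁z₂ a` is contractive and extends to `A`. To be a
multiplier it also needs an adjoint, built on the dense range of `k'²`, where `k'` is the analogue
of `k` for `z₁^*, z₂^*`; the relation `z₁z₂k² = k'²z₁z₂` makes the two extensions adjoint
(`exists_zTransform_product`).

By `closure_graph_composite` the graph of the composite has closure `{(c_z a, z a)}`: the vectors `a
= k e` already give points of the composite, and cancelling multipliers with dense range gives the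
reverse inclusion. Since `zk` and `c_z k` are symmetric in the two indices, both orders have the
same closure. -/

namespace CStarAffiliation

/-! ### Positive elements and intertwining identities -/

section Unital

variable {B : Type*} [CStarAlgebra B] [PartialOrder B] [StarOrderedRing B]

/-- If `r r^* ≤ h`, then `r` lies in the closed right ideal generated by `h`. -/
theorem exists_norm_sub_mul_le {h r : B} (hh : 0 ≤ h) (hr : r * star r ≤ h) {ε : ℝ} (hε : 0 < ε) :
    ∃ g : B, ‖r - h * g‖ ≤ ε := by
  have hδ : 0 < ε ^ 2 := by positivity
  have hsa : IsSelfAdjoint h := .of_nonneg hh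
  -- With `g = (h + ε²)⁻¹ r` the error is `R r`, `R = ε²(h + ε²)⁻¹`, and `‖R r‖² ≤ ‖R h R‖ ≤ ε²`.
  -- The absolute value only makes `f` continuous on all of `ℝ`.
  obtain ⟨f, hf⟩ : ∃ f : ℝ → ℝ, f = fun x => (|x| + ε ^ 2)⁻¹ := ⟨_, rfl⟩
  have hc : Continuous f := by
    rw [hf]
    exact (continuous_abs.add continuous_const).inv₀ fun x =>
      (add_pos_of_nonneg_of_pos (abs_nonneg x) hδ).ne'
  have hx : ∀ x ∈ spectrum ℝ h, 0 ≤ x ∧ f x = (x + ε ^ 2)⁻¹ := fun x hx => by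
    have hx0 : 0 ≤ x := spectrum_nonneg_of_nonneg hh hx
    rw [hf]
    exact ⟨hx0, by simp only [abs_of_nonneg hx0]⟩
  set G := cfc f h with hG
  set R := cfc (fun x => ε ^ 2 * f x) h with hR
  have hcR : Continuous (fun x => ε ^ 2 * f x) := continuous_const.mul hc
  have hRs : star R = R := (cfc_predicate (fun x => ε ^ 2 * f x) h).star_eq
  have hid : cfc (fun x : ℝ => x) h = h := cfc_id' ℝ h hsa
  have hhG : h * G = cfc (fun x => x * f x) h := by
    rw [cfc_mul (fun x : ℝ => x) f h continuousOn_id hc.continuousOn, hid]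
  have hsum : h * G + R = 1 := by
    rw [hhG, hR, ← cfc_add h (fun x => x * f x) (fun x => ε ^ 2 * f x)
      (continuous_id.mul hc).continuousOn hcR.continuousOn, ← cfc_const_one ℝ h]
    refine cfc_congr fun x hxs => ?_
    obtain ⟨hx0, hfx⟩ := hx x hxs
    have : x + ε ^ 2 ≠ 0 := by positivity
    rw [hfx]
    field_simp
  have hRhR : ‖R * h * R‖ ≤ ε ^ 2 := by
    have : R * h * R = cfc (fun x => ε ^ 2 * f x * x * (ε ^ 2 * f x)) h := by
      rw [cfc_mul (fun x => ε ^ 2 * f x * x) (fun x => ε ^ 2 * f x) h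
        (hcR.mul continuous_id).continuousOn hcR.continuousOn,
        cfc_mul (fun x => ε ^ 2 * f x) (fun x => x) h hcR.continuousOn continuousOn_id, hid]
    rw [this]
    refine norm_cfc_le hδ.le fun x hxs => ?_
    obtain ⟨hx0, hfx⟩ := hx x hxs
    rw [hfx, Real.norm_of_nonneg (by positivity)]
    have : ε ^ 2 * (x + ε ^ 2)⁻¹ * x * (ε ^ 2 * (x + ε ^ 2)⁻¹)
        = ε ^ 2 * (x * ε ^ 2 / (x + ε ^ 2) ^ 2) := by
      have : x + ε ^ 2 ≠ 0 := by positivity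
      field_simp
    rw [this]
    refine mul_le_of_le_one_right hδ.le (div_le_one_of_le₀ ?_ (by positivity))
    nlinarith [mul_nonneg hx0 hδ.le, sq_nonneg x, sq_nonneg (ε ^ 2)]
  refine ⟨G * r, ?_⟩
  have hrw : r - h * (G * r) = R * r := by
    rw [← mul_assoc, sub_eq_iff_eq_add', ← add_mul, hsum, one_mul]
  rw [hrw]
  refine le_of_sq_le_sq ?_ hε.le
  rw [sq, ← CStarRing.norm_self_mul_star]
  refine le_trans (CStarAlgebra.norm_le_norm_of_nonneg_of_le (mul_star_self_nonneg _) ?_) hRhR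
  have := star_left_conjugate_le_conjugate hr R
  rw [hRs] at this
  simpa only [star_mul, hRs, mul_assoc] using this

/-- A product of commuting positive elements squaring to the square of a positive element is that
element. -/
theorem mul_eq_of_commute_of_mul_self_eq {a b c : B} (ha : 0 ≤ a) (hb : 0 ≤ b) (hc : 0 ≤ c)
    (hab : Commute a b) (h : a * b * (a * b) = c * c) : a * b = c := by
  have hab0 : 0 ≤ a * b := hab.mul_nonneg ha hb
  rw [← CFC.sqrt_mul_self c hc, ← h, CFC.sqrt_mul_self _ hab0]

end Unital

section Ring

variable {R : Type*} [Ring R]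

/-- For `a, a'` commuting with `b, b'`, the product `a * b` intertwines the polynomial
`(1 - a' a)(1 - b' b) + a' a b' b` and its counterpart in `a a'` and `b b'`. -/
theorem mul_intertwine {a a' b b' : R} (h₁ : a * b = b * a) (h₂ : a * b' = b' * a)
    (h₃ : a' * b = b * a') :
    a * b * ((1 - a' * a) * (1 - b' * b) + a' * a * (b' * b)) =
      ((1 - a * a') * (1 - b * b') + a * a' * (b * b')) * (a * b) := by
  have e : ∀ {x y : R}, x * y = y * x → ∀ w, y * (x * w) = x * (y * w) := fun h w => by
    rw [← mul_assoc, ← h, mul_assoc]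
  simp only [mul_add, add_mul, mul_sub, sub_mul, mul_one, one_mul, mul_assoc, ← h₁, e h₁, e h₂,
    e h₃]

end Ring

section Unital

variable {B : Type*} [CStarAlgebra B] [PartialOrder B] [StarOrderedRing B]

theorem exists_sqrt_commuting {h : B} (hh : 0 ≤ h) :
    ∃ k : B, 0 ≤ k ∧ k * k = h ∧ ∀ x, Commute h x → Commute k x := by
  refine ⟨cfc Real.sqrt h, cfc_nonneg fun x _ => Real.sqrt_nonneg x, ?_,
    fun x hx => hx.cfc_real _⟩
  rw [← cfc_mul Real.sqrt Real.sqrt h (by fun_prop) (by fun_prop)]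
  conv_rhs => rw [← cfc_id ℝ h (.of_nonneg hh)]
  exact cfc_congr fun x hx => Real.mul_self_sqrt (spectrum_nonneg_of_nonneg hh hx)

end Unital

/-! ### Multipliers with dense range -/

variable {A : Type*} [NonUnitalCStarAlgebra A]

theorem norm_le_norm_of_star_mul_self_eq_add {x y w : A}
    (h : star y * y = star x * x + star w * w) : ‖x‖ ≤ ‖y‖ := by
  let _ := CStarAlgebra.spectralOrder A
  have := CStarAlgebra.spectralOrderedRing A
  refine le_of_sq_le_sq ?_ (norm_nonneg y)
  rw [sq, sq, ← CStarRing.norm_star_mul_self, ← CStarRing.norm_star_mul_self]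
  refine CStarAlgebra.norm_le_norm_of_nonneg_of_le (star_mul_self_nonneg x) ?_
  rw [h]
  exact le_add_of_nonneg_right (star_mul_self_nonneg w)

theorem eq_of_forall_star_mul_eq {x y : A} (h : ∀ a : A, star a * x = star a * y) : x = y := by
  have h0 : star (x - y) * (x - y) = 0 := by rw [mul_sub, h, sub_self]
  exact sub_eq_zero.1 ((CStarRing.star_mul_self_eq_zero_iff _).1 h0)

theorem multiplier_ext {m n : 𝓜(ℂ, A)} (h : ∀ a, m.fst a = n.fst a) : m = n := by
  have h1 : m.fst = n.fst := ContinuousLinearMap.ext h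
  rw [← sub_eq_zero, ← norm_eq_zero, ← DoubleCentralizer.norm_fst, DoubleCentralizer.sub_fst,
    h1, sub_self, norm_zero]

theorem mul_fst_apply (m n : 𝓜(ℂ, A)) (a : A) : (m * n).fst a = m.fst (n.fst a) := rfl

theorem star_fst_mul (m : 𝓜(ℂ, A)) (a b : A) :
    star (m.fst a) * b = star a * (star m).fst b := by
  have := star_fst_mul_fst m 1 a b
  rw [mul_one] at this
  simpa using! this

theorem denseRange_mul_fst {m n : 𝓜(ℂ, A)} (hm : DenseRange m.fst) (hn : DenseRange n.fst) :
    DenseRange (m * n).fst :=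
  hm.comp hn m.fst.continuous

theorem denseRange_of_mul_fst {m n : 𝓜(ℂ, A)} (h : DenseRange (m * n).fst) : DenseRange m.fst := by
  refine Dense.mono ?_ h
  rintro _ ⟨a, rfl⟩
  exact ⟨n.fst a, rfl⟩

theorem mul_right_cancel_of_denseRange {m x y : 𝓜(ℂ, A)} (hm : DenseRange m.fst)
    (h : x * m = y * m) : x = y := by
  refine multiplier_ext fun a => ?_
  refine congrFun (hm.equalizer x.fst.continuous y.fst.continuous ?_) a
  funext b
  simp only [Function.comp_apply, ← mul_fst_apply, h]

/-- The kernel of a self-adjoint multiplier is orthogonal to its range. This replaces invertibility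
in all later cancellations. -/
theorem fst_injective_of_denseRange {m : 𝓜(ℂ, A)} (hs : star m = m) (hm : DenseRange m.fst) :
    Function.Injective m.fst := by
  intro a b h
  refine eq_of_forall_star_mul_eq fun c => ?_
  refine hm.induction_on (p := fun c => star c * a = star c * b) c
    (isClosed_eq (by fun_prop) (by fun_prop)) fun c => ?_
  rw [star_fst_mul, star_fst_mul, hs, h]

theorem mul_left_cancel_of_denseRange {m x y : 𝓜(ℂ, A)} (hs : star m = m) (hm : DenseRange m.fst)
    (h : m * x = m * y) : x = y :=
  multiplier_ext fun a => fst_injective_of_denseRange hs hm <| by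
    rw [← mul_fst_apply, ← mul_fst_apply, h]

/-- Since `r r^* ≤ h`, `r` is a norm limit of multipliers `h g`, so the closure of the range of `h`
contains that of `r`. -/
theorem denseRange_of_eq_add {h r d : 𝓜(ℂ, A)} (hr : DenseRange r.fst)
    (hh : h = r * star r + d * star d) : DenseRange h.fst := by
  let _ := CStarAlgebra.spectralOrder 𝓜(ℂ, A)
  have := CStarAlgebra.spectralOrderedRing 𝓜(ℂ, A)
  have hle : r * star r ≤ h := by
    rw [hh]; exact le_add_of_nonneg_right (mul_star_self_nonneg d)
  have h0 : 0 ≤ h := (mul_star_self_nonneg r).trans hle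
  have hmem : ∀ a, r.fst a ∈ closure (Set.range h.fst) := by
    intro a
    refine Metric.mem_closure_iff.2 fun ε hε => ?_
    have hpos : 0 < ‖a‖ + 1 := by positivity
    obtain ⟨g, hg⟩ := exists_norm_sub_mul_le h0 hle (div_pos hε hpos)
    refine ⟨h.fst (g.fst a), ⟨_, rfl⟩, ?_⟩
    rw [dist_eq_norm, ← mul_fst_apply]
    calc ‖r.fst a - (h * g).fst a‖ = ‖(r - h * g).fst a‖ := rfl
      _ ≤ ‖(r - h * g).fst‖ * ‖a‖ := (r - h * g).fst.le_opNorm a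
      _ ≤ ε / (‖a‖ + 1) * ‖a‖ := by
        rw [DoubleCentralizer.norm_fst]
        gcongr
      _ < ε / (‖a‖ + 1) * (‖a‖ + 1) := by
        gcongr
        linarith
      _ = ε := div_mul_cancel₀ _ hpos.ne'
  have hsub : Set.range r.fst ⊆ closure (Set.range h.fst) := by
    rintro _ ⟨a, rfl⟩
    exact hmem a
  exact dense_closure.1 (Dense.mono hsub hr)

/-- Factorization of multipliers through multipliers with dense range. -/
theorem exists_multiplier_mul_eq {m k l j d e : 𝓜(ℂ, A)} (hk : DenseRange k.fst)
    (hj : DenseRange j.fst) (hmk : star k * k = star m * m + star d * d)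
    (hlj : star j * j = star l * l + star e * e) (hadj : star m * j = star k * l) :
    ∃ z : 𝓜(ℂ, A), ‖z‖ ≤ 1 ∧ z * k = m := by
  have bound : ∀ {m k d : 𝓜(ℂ, A)}, star k * k = star m * m + star d * d →
      ∀ a, ‖(m.fst : A →ₗ[ℂ] A) a‖ ≤ 1 * ‖(k.fst : A →ₗ[ℂ] A) a‖ := by
    intro m k d h a
    rw [one_mul]
    refine norm_le_norm_of_star_mul_self_eq_add (w := d.fst a) ?_
    change star (k.fst a) * k.fst a = star (m.fst a) * m.fst a + _
    rw [star_fst_mul_fst, star_fst_mul_fst, star_fst_mul_fst, h, ← mul_add]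
    rfl
  let F : A →L[ℂ] A := (m.fst : A →ₗ[ℂ] A).extendOfNorm (k.fst : A →ₗ[ℂ] A)
  let G : A →L[ℂ] A := (l.fst : A →ₗ[ℂ] A).extendOfNorm (j.fst : A →ₗ[ℂ] A)
  have hF : ∀ a, F (k.fst a) = m.fst a :=
    LinearMap.extendOfNorm_eq (f := (m.fst : A →ₗ[ℂ] A)) hk ⟨1, bound hmk⟩
  have hG : ∀ a, G (j.fst a) = l.fst a :=
    LinearMap.extendOfNorm_eq (f := (l.fst : A →ₗ[ℂ] A)) hj ⟨1, bound hlj⟩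
  -- `F` and `G` are mutually adjoint: on the dense ranges this is `hadj`, and both sides are
  -- continuous.
  have hFG : ∀ x y, star (F x) * y = star x * G y := by
    intro x y
    refine hj.induction_on (p := fun y => star (F x) * y = star x * G y) y
      (isClosed_eq (by fun_prop) (by fun_prop)) fun c => ?_
    refine hk.induction_on (p := fun x => star (F x) * j.fst c = star x * G (j.fst c)) x
      (isClosed_eq (by fun_prop) (by fun_prop)) fun b => ?_
    rw [hF, hG, star_fst_mul_fst, star_fst_mul_fst, hadj]
  -- The right action of a multiplier is its adjoint's left action conjugated by the involution.
  let Gs : A →L[ℂ] A :=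
    { toFun := fun x => star (G (star x))
      map_add' := fun x y => by simp
      map_smul' := fun c x => by simp
      cont := by fun_prop }
  let z : 𝓜(ℂ, A) :=
    { fst := F
      snd := Gs
      central := fun x y => by
        change star (G (star x)) * y = x * F y
        have := congrArg star (hFG y (star x))
        simpa using this.symm }
  refine ⟨z, ?_, multiplier_ext hF⟩
  rw [← DoubleCentralizer.norm_fst]
  exact LinearMap.opNorm_extendOfNorm_le (f := (m.fst : A →ₗ[ℂ] A)) hk zero_le_one (bound hmk)

theorem commute_cosMul {x z : 𝓜(ℂ, A)} (h : Commute x z) (h' : Commute x (star z)) :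
    Commute x (cosMul z) :=
  (Commute.cfc_real ((Commute.one_left x).sub_left (h'.mul_right h).symm) Real.sqrt).symm

theorem one_sub_star_mul_self_eq {z : 𝓜(ℂ, A)} (hz : ‖z‖ ≤ 1) :
    star z * z = 1 - cosMul z * cosMul z := by
  rw [cosMul_mul_self z hz, sub_sub_cancel]

theorem denseRange_cosMul {T : A →ₗ.[ℂ] A} {z : 𝓜(ℂ, A)} (hT : Dense (T.domain : Set A))
    (hz : IsZTransform T z) : DenseRange (cosMul z).fst := by
  refine Dense.mono ?_ hT
  intro x hx
  obtain ⟨a, ha, -⟩ := (hz.2 x (T ⟨x, hx⟩)).1 ⟨hx, rfl⟩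
  exact ⟨a, ha.symm⟩

/-- Since `z(1 - z^* z) = (1 - z z^*)z`, density of the range of `1 - z^* z` puts `zA` in the closed
range `J` of `1 - z z^*`; then `a = (1 - z z^*)a + z z^* a` lies in `J`. -/
theorem denseRange_one_sub_mul_star {z : 𝓜(ℂ, A)} (hz : ‖z‖ ≤ 1)
    (hd : DenseRange (cosMul z).fst) : DenseRange (1 - z * star z).fst := by
  let J : Submodule ℂ A :=
    (LinearMap.range ((1 - z * star z).fst : A →ₗ[ℂ] A)).topologicalClosure
  have hJ : IsClosed (J : Set A) := Submodule.isClosed_topologicalClosure _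
  have hmem : ∀ a, (1 - z * star z).fst a ∈ J := fun a =>
    Submodule.le_topologicalClosure _ ⟨a, rfl⟩
  have hzJ : ∀ a, z.fst a ∈ J := fun a => by
    have hd2 := denseRange_mul_fst hd hd
    rw [cosMul_mul_self z hz] at hd2
    refine hd2.induction_on (p := fun a => z.fst a ∈ J) a
      (hJ.preimage z.fst.continuous) fun b => ?_
    have : z * (1 - star z * z) = (1 - z * star z) * z := by
      rw [mul_sub, sub_mul, mul_one, one_mul, mul_assoc]
    rw [← mul_fst_apply, this]
    exact hmem _
  have hall : ∀ a, a ∈ J := fun a => by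
    have : a = (1 - z * star z).fst a + z.fst ((star z).fst a) := by
      rw [DoubleCentralizer.sub_fst]
      exact (sub_add_cancel a _).symm
    rw [this]
    exact J.add_mem (hmem a) (hzJ _)
  exact fun a => hall a

/-! ### The `z`-transform of the product -/

theorem exists_zTransform_product {z₁ z₂ : 𝓜(ℂ, A)} (hz₁ : ‖z₁‖ ≤ 1) (hz₂ : ‖z₂‖ ≤ 1)
    (hd₁ : DenseRange (cosMul z₁).fst) (hd₂ : DenseRange (cosMul z₂).fst)
    (h : Commute z₁ z₂) (h' : Commute (star z₁) z₂) :
    ∃ z k : 𝓜(ℂ, A), ‖z‖ ≤ 1 ∧ star k = k ∧ DenseRange k.fst ∧ Commute k (cosMul z₁) ∧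
      Commute k (cosMul z₂) ∧ z * k = z₁ * z₂ ∧ cosMul z * k = cosMul z₁ * cosMul z₂ ∧
      Commute (cosMul z) k := by
  let _ := CStarAlgebra.spectralOrder 𝓜(ℂ, A)
  have := CStarAlgebra.spectralOrderedRing 𝓜(ℂ, A)
  have hs : Commute z₁ (star z₂) := by simpa using h'.star_star
  have hss : Commute (star z₁) (star z₂) := h.star_star
  have nonneg : ∀ z : 𝓜(ℂ, A), 0 ≤ cosMul z := fun z => cfc_nonneg fun x _ => Real.sqrt_nonneg x
  -- square root of `(1 - x^* x)(1 - y^* y) + x^* x y^* y` for `x, x^*` commuting with `y, y^*`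
  have root : ∀ {x y : 𝓜(ℂ, A)}, ‖x‖ ≤ 1 → ‖y‖ ≤ 1 → Commute x y → Commute (star x) y →
      DenseRange (cosMul x).fst → DenseRange (cosMul y).fst →
      ∃ k : 𝓜(ℂ, A), 0 ≤ k ∧
        k * k = (1 - star x * x) * (1 - star y * y) + star x * x * (star y * y) ∧
        k * k = star (x * y) * (x * y) + star (cosMul x * cosMul y) * (cosMul x * cosMul y) ∧
        DenseRange (k * k).fst ∧ Commute (cosMul x) (cosMul y) ∧ Commute k (cosMul x) ∧
        Commute k (cosMul y) ∧ Commute k (star (x * y) * (x * y)) := by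
    intro x y hx hy hxy hxy' hdx hdy
    have hys : Commute y (star x) := hxy'.symm
    have hxs : Commute x (star y) := by simpa using hxy'.star_star
    have hxss : Commute (star x) (star y) := hxy.star_star
    have hyc : Commute y (cosMul x) := commute_cosMul hxy.symm hys
    have hysc : Commute (star y) (cosMul x) := commute_cosMul hxs.symm hxss.symm
    have hcc : Commute (cosMul x) (cosMul y) := commute_cosMul hyc.symm hysc.symm
    have hsx : Commute (star x * x) (cosMul x) := by
      rw [one_sub_star_mul_self_eq hx]
      exact (Commute.one_left _).sub_left ((Commute.refl _).mul_left (Commute.refl _))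
    have hsy : Commute (star y * y) (cosMul y) := by
      rw [one_sub_star_mul_self_eq hy]
      exact (Commute.one_left _).sub_left ((Commute.refl _).mul_left (Commute.refl _))
    have hxcy : Commute x (cosMul y) := commute_cosMul hxy hxs
    have hsxcy : Commute (star x) (cosMul y) := commute_cosMul hxy' hxss
    have e1 : star (x * y) * (x * y) = star x * x * (star y * y) := by
      rw [star_mul, mul_assoc, ← mul_assoc (star x), ← mul_assoc,
        ← ((hxss.mul_left hxs).eq), mul_assoc]
    have e2 : star (cosMul x * cosMul y) * (cosMul x * cosMul y) =
        (1 - star x * x) * (1 - star y * y) := by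
      rw [← cosMul_mul_self x hx, ← cosMul_mul_self y hy, star_mul, cosMul_isSelfAdjoint,
        cosMul_isSelfAdjoint, ← hcc.eq, mul_assoc, ← mul_assoc (cosMul y), ← hcc.eq]
      simp only [mul_assoc]
    set w := star (x * y) * (x * y) + star (cosMul x * cosMul y) * (cosMul x * cosMul y) with hw
    have hwp : w = (1 - star x * x) * (1 - star y * y) + star x * x * (star y * y) := by
      rw [hw, e1, e2, add_comm]
    have hw0 : 0 ≤ w := add_nonneg (star_mul_self_nonneg _) (star_mul_self_nonneg _)
    obtain ⟨k, hk0, hkk, hkc⟩ := exists_sqrt_commuting hw0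
    have hcom : ∀ v, Commute (star x * x) v → Commute (star y * y) v → Commute k v :=
      fun v h1 h2 => hkc v <| by
        rw [hwp]
        exact (((Commute.one_left v).sub_left h1).mul_left
          ((Commute.one_left v).sub_left h2)).add_left (h1.mul_left h2)
    have hxxyy : Commute (star x * x) (star y * y) :=
      (hxss.mul_left hxs).mul_right (hxy'.mul_left hxy)
    refine ⟨k, hk0, hkk.trans hwp, hkk, ?_, hcc, hcom _ hsx (hysc.mul_left hyc),
      hcom _ (hsxcy.mul_left hxcy) hsy, ?_⟩
    · rw [hkk]
      refine denseRange_of_eq_add (r := cosMul x * cosMul y) (d := star (x * y))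
        (denseRange_mul_fst hdx hdy) ?_
      rw [hw, star_star, add_comm, star_mul, cosMul_isSelfAdjoint, cosMul_isSelfAdjoint, hcc.eq]
    · rw [e1]
      exact hcom _ ((Commute.refl _).mul_right hxxyy) (hxxyy.symm.mul_right (Commute.refl _))
  have dense' : ∀ {z : 𝓜(ℂ, A)}, ‖z‖ ≤ 1 → DenseRange (cosMul z).fst →
      DenseRange (cosMul (star z)).fst := fun {z} hz hd => by
    have := denseRange_one_sub_mul_star hz hd
    refine denseRange_of_mul_fst (n := cosMul (star z)) ?_
    rwa [cosMul_mul_self _ (by rwa [norm_star]), star_star]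
  obtain ⟨k, hk0, hkp, hkk, hkd, hcc, hk₁, hk₂, hkm⟩ := root hz₁ hz₂ h h' hd₁ hd₂
  obtain ⟨k', hk'0, hkp', hkk', hkd', hcc', hk₁', hk₂', -⟩ :=
    root (x := star z₁) (y := star z₂) (by rwa [norm_star]) (by rwa [norm_star]) hss
      (by rwa [star_star]) (dense' hz₁ hd₁) (dense' hz₂ hd₂)
  rw [star_star, star_star] at hkp'
  have hks : star k = k := (IsSelfAdjoint.of_nonneg hk0).star_eq
  have hks' : star k' = k' := (IsSelfAdjoint.of_nonneg hk'0).star_eq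
  have hkdense : DenseRange k.fst := denseRange_of_mul_fst hkd
  have hint : z₁ * z₂ * (k * k) = k' * k' * (z₁ * z₂) := by
    rw [hkp, hkp']
    exact mul_intertwine h.eq hs.eq h'.eq
  have hint' : star (z₁ * z₂) * (k' * k') = k * k * star (z₁ * z₂) := by
    have := congrArg star hint
    simp only [star_mul, hks, hks', mul_assoc] at this ⊢
    exact this.symm
  -- The adjoint should be `k⁻¹(z₁z₂)^*`. As `(z₁z₂)^* k'² = k²(z₁z₂)^*`, its value at `k'² a` is
  -- `k(z₁z₂)^* a`, which involves no inverse; hence `j` and `l`.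
  obtain ⟨z, hz, hzk⟩ := exists_multiplier_mul_eq (m := z₁ * z₂) (k := k) (j := k' * k')
    (l := k * star (z₁ * z₂)) (d := cosMul z₁ * cosMul z₂)
    (e := k' * (cosMul (star z₁) * cosMul (star z₂))) hkdense hkd' (by rw [hks, hkk])
    (by
      have hk'c := hk₁'.mul_right hk₂'
      set c := cosMul (star z₁) * cosMul (star z₂)
      have e1 : star (k * star (z₁ * z₂)) * (k * star (z₁ * z₂)) =
          k' * k' * (star (star z₁ * star z₂) * (star z₁ * star z₂)) := by
        have hst : star z₁ * star z₂ = star (z₁ * z₂) := by rw [h.eq, star_mul]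
        rw [hst, star_star, star_mul, star_star, hks, mul_assoc, ← mul_assoc k, ← mul_assoc, hint,
          mul_assoc]
      have hcs : star c = c := by
        simp only [c, star_mul, cosMul_isSelfAdjoint, hcc'.eq]
      have e2 : star (k' * c) * (k' * c) = k' * k' * (star c * c) := by
        rw [star_mul, hks', hcs, ← hk'c.eq, mul_assoc, ← mul_assoc c, ← hk'c.eq]
        simp only [mul_assoc]
      rw [e1, e2, ← mul_add, ← hkk', star_mul, hks'])
    (by rw [hint', hks, mul_assoc])
  have hkz : k * star z = star (z₁ * z₂) := by rw [← hzk, star_mul, hks]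
  -- `k z^* z k = (z₁z₂)^* z₁z₂` commutes with `k`; cancel one `k` on each side.
  have hzz : Commute (star z * z) k := by
    have hw : k * (star z * z * k) = star (z₁ * z₂) * (z₁ * z₂) := by
      rw [mul_assoc, ← mul_assoc, hkz, hzk]
    refine mul_right_cancel_of_denseRange hkdense (mul_left_cancel_of_denseRange hks hkdense ?_)
    calc k * (star z * z * k * k) = k * (star z * z * k) * k := (mul_assoc ..).symm
      _ = k * (k * (star z * z * k)) := by rw [hw, hkm.eq]
      _ = k * (k * (star z * z) * k) := by rw [mul_assoc k (star z * z)]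
  have hck : Commute (cosMul z) k :=
    Commute.cfc_real ((Commute.one_left k).sub_left hzz) Real.sqrt
  refine ⟨z, k, hz, hks, hkdense, hk₁, hk₂, hzk, ?_, hck⟩
  refine mul_eq_of_commute_of_mul_self_eq (nonneg z) hk0
    (hcc.mul_nonneg (nonneg _) (nonneg _)) hck ?_
  have hsc : star (cosMul z₁ * cosMul z₂) = cosMul z₁ * cosMul z₂ := by
    rw [star_mul, cosMul_isSelfAdjoint, cosMul_isSelfAdjoint, hcc.eq]
  rw [hsc] at hkk
  calc cosMul z * k * (cosMul z * k) = k * (cosMul z * cosMul z) * k := by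
        rw [hck.eq, mul_assoc, mul_assoc, mul_assoc, hck.eq]
    _ = k * k - star (z₁ * z₂) * (z₁ * z₂) := by
        rw [cosMul_mul_self z hz, mul_sub, sub_mul, mul_one, ← mul_assoc, hkz, mul_assoc, hzk]
    _ = _ := by rw [hkk, add_sub_cancel_left]

/-! ### Graphs and their closures -/

/-- The graph `{((1 - z^* z)^{1/2} a, z a) | a ∈ A}`. -/
noncomputable def transformGraph (z : 𝓜(ℂ, A)) : Submodule ℂ (A × A) :=
  LinearMap.range (((cosMul z).fst.prod z.fst : A →L[ℂ] A × A) : A →ₗ[ℂ] A × A)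

theorem mem_transformGraph {z : 𝓜(ℂ, A)} {x y : A} :
    (x, y) ∈ transformGraph z ↔ ∃ a, x = (cosMul z).fst a ∧ y = z.fst a := by
  refine ⟨?_, ?_⟩
  · rintro ⟨a, ha⟩
    obtain ⟨h1, h2⟩ := Prod.ext_iff.1 ha
    exact ⟨a, h1.symm, h2.symm⟩
  · rintro ⟨a, rfl, rfl⟩
    exact ⟨a, rfl⟩

theorem add_star_fst_eq {z : 𝓜(ℂ, A)} (hz : ‖z‖ ≤ 1) (a : A) :
    (cosMul z).fst ((cosMul z).fst a) + (star z).fst (z.fst a) = a := by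
  have : cosMul z * cosMul z + star z * z = 1 := by
    rw [cosMul_mul_self z hz, sub_add_cancel]
  exact congrArg (fun m : 𝓜(ℂ, A) => m.fst a) this

/-- The parameter of a point `(x, y)` can only be `c x + z^* y`, a continuous function of the point,
so the graph is cut out by equations. -/
theorem isClosed_transformGraph {z : 𝓜(ℂ, A)} (hz : ‖z‖ ≤ 1) :
    IsClosed (transformGraph z : Set (A × A)) := by
  have : (transformGraph z : Set (A × A)) = {p | p.1 = (cosMul z).fst
      ((cosMul z).fst p.1 + (star z).fst p.2) ∧
      p.2 = z.fst ((cosMul z).fst p.1 + (star z).fst p.2)} := by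
    ext ⟨x, y⟩
    refine ⟨fun h => ?_, fun h => mem_transformGraph.2 ⟨_, h⟩⟩
    obtain ⟨a, rfl, rfl⟩ := mem_transformGraph.1 h
    simp only [Set.mem_ofPred_eq, add_star_fst_eq hz, and_self]
  rw [this]
  exact (isClosed_eq (by fun_prop) (by fun_prop)).inter (isClosed_eq (by fun_prop) (by fun_prop))

theorem isZTransform_iff_graph {T : A →ₗ.[ℂ] A} {z : 𝓜(ℂ, A)} :
    IsZTransform T z ↔ ‖z‖ ≤ 1 ∧ T.graph = transformGraph z := by
  have hT : ∀ x y, (x, y) ∈ T.graph ↔ ∃ hx : x ∈ T.domain, T ⟨x, hx⟩ = y := fun x y => by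
    rw [LinearPMap.mem_graph_iff]
    constructor
    · rintro ⟨u, rfl, hu⟩
      exact ⟨u.2, hu⟩
    · rintro ⟨hx, hy⟩
      exact ⟨⟨x, hx⟩, rfl, hy⟩
  simp only [IsZTransform, ← hT, ← mem_transformGraph, Submodule.ext_iff, Prod.forall]

theorem isZTransform_toLinearPMap {z : 𝓜(ℂ, A)} (hz : ‖z‖ ≤ 1)
    (hd : DenseRange (cosMul z).fst) : IsZTransform (transformGraph z).toLinearPMap z := by
  refine isZTransform_iff_graph.2 ⟨hz, Submodule.toLinearPMap_graph_eq _ ?_⟩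
  rintro ⟨x, y⟩ h (rfl : x = 0)
  obtain ⟨a, ha, rfl⟩ := mem_transformGraph.1 h
  have : a = 0 := fst_injective_of_denseRange (cosMul_isSelfAdjoint z) hd (by rw [← ha, map_zero])
  simp [this]

theorem mem_graph_composite {T₁ T₂ : A →ₗ.[ℂ] A} {z₁ z₂ : 𝓜(ℂ, A)} (h₁ : IsZTransform T₁ z₁)
    (h₂ : IsZTransform T₂ z₂) {x y : A} :
    (x, y) ∈ (composite T₁ T₂).graph ↔ ∃ b d, x = (cosMul z₂).fst b ∧
      z₂.fst b = (cosMul z₁).fst d ∧ y = z₁.fst d := by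
  rw [LinearPMap.mem_graph_iff]
  constructor
  · rintro ⟨⟨_, hx, hx'⟩, rfl, rfl⟩
    obtain ⟨b, hb, hb'⟩ := (h₂.2 _ _).1 ⟨hx, rfl⟩
    obtain ⟨d, hd, hd'⟩ := (h₁.2 _ _).1 ⟨hx', rfl⟩
    exact ⟨b, d, hb, hb'.symm.trans hd, hd'⟩
  · rintro ⟨b, d, rfl, hbd, rfl⟩
    obtain ⟨hx, hx'⟩ := (h₂.2 _ _).2 ⟨b, rfl, rfl⟩
    obtain ⟨hy, hy'⟩ := (h₁.2 _ _).2 ⟨d, rfl, rfl⟩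
    have hmem : T₂ ⟨_, hx⟩ ∈ T₁.domain := by rw [hx', hbd]; exact hy
    refine ⟨⟨_, hx, hmem⟩, rfl, ?_⟩
    refine (composite_apply T₁ T₂ _ hx hmem).trans ?_
    change _ = z₁.fst d
    rw [← hy']
    congr 1
    exact Subtype.ext (hx'.trans hbd)

theorem closure_graph_composite {T₁ T₂ : A →ₗ.[ℂ] A} {z₁ z₂ z k : 𝓜(ℂ, A)}
    (h₁ : IsZTransform T₁ z₁) (h₂ : IsZTransform T₂ z₂) (hd₁ : DenseRange (cosMul z₁).fst)
    (h : Commute z₁ z₂) (h' : Commute (star z₁) z₂) (hz : ‖z‖ ≤ 1)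
    (hcz : DenseRange (cosMul z).fst) (hks : star k = k) (hk : DenseRange k.fst)
    (hkc₁ : Commute k (cosMul z₁)) (hck : Commute (cosMul z) k) (hzk : z * k = z₁ * z₂)
    (hczk : cosMul z * k = cosMul z₁ * cosMul z₂) :
    (composite T₁ T₂).graph.topologicalClosure = transformGraph z := by
  have hs : Commute z₁ (star z₂) := by simpa using h'.star_star
  have hss : Commute (star z₁) (star z₂) := h.star_star
  have hz₂c : Commute z₂ (cosMul z₁) := commute_cosMul h.symm h'.symm
  have hz₂sc : Commute (star z₂) (cosMul z₁) := commute_cosMul hs.symm hss.symm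
  have hcc : Commute (cosMul z₁) (cosMul z₂) := commute_cosMul hz₂c.symm hz₂sc.symm
  have hz₁c₂ : Commute z₁ (cosMul z₂) := commute_cosMul h hs
  have hz₁sc₂ : Commute (star z₁) (cosMul z₂) := commute_cosMul h' hss
  have hkz : k * star z = star z₂ * star z₁ := by rw [← star_mul, ← hzk, star_mul, hks]
  have act : ∀ {m n : 𝓜(ℂ, A)}, m = n → ∀ a, m.fst a = n.fst a := fun h a => by rw [h]
  apply le_antisymm
  · refine Submodule.topologicalClosure_minimal _ ?_ (isClosed_transformGraph hz)
    rintro ⟨a, y⟩ hay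
    obtain ⟨b, d, rfl, hbd, rfl⟩ := (mem_graph_composite h₁ h₂).1 hay
    set a := (cosMul z₂).fst b with ha
    -- The only possible parameter of `(a, y)`, where `y = z₁ d`, by `add_star_fst_eq`.
    set x := (cosMul z).fst a + (star z).fst (z₁.fst d) with hx
    have hzzk : Commute (star z * z) k := by
      rw [one_sub_star_mul_self_eq hz]
      exact (Commute.one_left _).sub_left (hck.mul_left hck)
    -- `k² z^* z a = k² (1 - z^* z)^{1/2} z^* y`
    have hax : (star z * z).fst a = (cosMul z).fst ((star z).fst (z₁.fst d)) := by
      refine fst_injective_of_denseRange hks hk (fst_injective_of_denseRange hks hk ?_)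
      have e1 : k * k * (star z * z) * cosMul z₂ =
          cosMul z₂ * (star z₁ * z₁) * star z₂ * z₂ := by
        have : k * k * (star z * z) = star z₂ * star z₁ * (z₁ * z₂) := by
          rw [mul_assoc, ← hzzk.eq, mul_assoc (star z), hzk, ← mul_assoc, hkz]
        rw [this]
        have e2 : Commute (star z₂ * z₂) (cosMul z₂) := by
          rw [one_sub_star_mul_self_eq h₂.1]
          exact (Commute.one_left _).sub_left ((Commute.refl _).mul_left (Commute.refl _))
        have e3 : star z₂ * star z₁ * (z₁ * z₂) = star z₁ * z₁ * (star z₂ * z₂) := by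
          rw [mul_assoc, ← mul_assoc (star z₁), ← mul_assoc, ← (hss.mul_left hs).eq, mul_assoc]
        rw [e3, ((hz₁sc₂.mul_left hz₁c₂).mul_left e2).eq]
        simp only [mul_assoc]
      have e4 : k * k * (cosMul z * star z) * z₁ =
          cosMul z₂ * (star z₁ * z₁) * star z₂ * cosMul z₁ := by
        have e5 : Commute (star z₁ * z₁) (cosMul z₁) := by
          rw [one_sub_star_mul_self_eq h₁.1]
          exact (Commute.one_left _).sub_left ((Commute.refl _).mul_left (Commute.refl _))
        calc k * k * (cosMul z * star z) * z₁ = k * (k * cosMul z) * star z * z₁ := by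
              simp only [mul_assoc]
          _ = cosMul z * k * (k * star z) * z₁ := by
              rw [← hck.eq, ← mul_assoc k, ← hck.eq]
              simp only [mul_assoc]
          _ = cosMul z₁ * cosMul z₂ * (star z₂ * star z₁ * z₁) := by
              rw [hczk, hkz, mul_assoc]
          _ = cosMul z₂ * (cosMul z₁ * (star z₁ * z₁ * star z₂)) := by
              rw [hcc.eq, mul_assoc, mul_assoc (star z₂), (hss.mul_left hs).eq]
          _ = _ := by
              rw [(e5.symm.mul_right hz₂sc.symm).eq]
              simp only [mul_assoc]
      calc k.fst (k.fst ((star z * z).fst a)) = (k * k * (star z * z) * cosMul z₂).fst b := rfl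
        _ = (cosMul z₂ * (star z₁ * z₁) * star z₂).fst (z₂.fst b) := by rw [e1]; rfl
        _ = (cosMul z₂ * (star z₁ * z₁) * star z₂ * cosMul z₁).fst d := by rw [hbd]; rfl
        _ = k.fst (k.fst ((cosMul z).fst ((star z).fst (z₁.fst d)))) := by rw [← e4]; rfl
    have hacx : a = (cosMul z).fst x := by
      rw [hx, map_add, ← hax]
      exact (add_star_fst_eq hz a).symm
    refine mem_transformGraph.2 ⟨x, hacx, ?_⟩
    -- `(1 - z₁ z₁^*) y = (1 - z₁ z₁^*) z x`
    have hdense := denseRange_one_sub_mul_star h₁.1 hd₁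
    refine fst_injective_of_denseRange (by simp) hdense ?_
    have i1 : (1 - z₁ * star z₁) * z₁ = z₁ * (cosMul z₁ * cosMul z₁) := by
      rw [cosMul_mul_self z₁ h₁.1, mul_sub, sub_mul, mul_one, one_mul, mul_assoc]
    have i2 : (1 - z₁ * star z₁) * z = z * (cosMul z₁ * cosMul z₁) := by
      refine mul_right_cancel_of_denseRange hk ?_
      rw [mul_assoc, hzk, ← mul_assoc, i1, mul_assoc, ← (hz₂c.mul_right hz₂c).eq, mul_assoc,
        ← (hkc₁.mul_right hkc₁).eq, ← mul_assoc z, hzk, mul_assoc z₁]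
    have hcp : Commute (cosMul z) (cosMul z₁) := by
      refine mul_right_cancel_of_denseRange hk ?_
      calc cosMul z * cosMul z₁ * k = cosMul z * k * cosMul z₁ := by
            rw [mul_assoc, ← hkc₁.eq, mul_assoc]
        _ = cosMul z₁ * cosMul z * k := by
            rw [hczk, mul_assoc, ← hcc.eq, mul_assoc, hczk]
    have i3 : (cosMul z₁ * cosMul z₁).fst x = (k * cosMul z₁).fst b := by
      refine fst_injective_of_denseRange (cosMul_isSelfAdjoint z) hcz ?_
      have i4 : cosMul z * (k * cosMul z₁) = cosMul z₁ * cosMul z₁ * cosMul z₂ := by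
        rw [← mul_assoc, hczk, mul_assoc, ← hcc.eq, mul_assoc]
      calc (cosMul z).fst ((cosMul z₁ * cosMul z₁).fst x)
          = (cosMul z₁ * cosMul z₁).fst ((cosMul z).fst x) := act (hcp.mul_right hcp).eq x
        _ = (cosMul z * (k * cosMul z₁)).fst b := by rw [← hacx, i4]; rfl
    calc (1 - z₁ * star z₁).fst (z₁.fst d) = (z₁ * cosMul z₁).fst ((cosMul z₁).fst d) := by
          rw [← mul_fst_apply, i1]; rfl
      _ = (z₁ * (cosMul z₁ * z₂)).fst b := by rw [← hbd]; rfl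
      _ = (z * (k * cosMul z₁)).fst b := by
          rw [← hz₂c.eq, ← mul_assoc, ← mul_assoc, hzk]
      _ = (z * (cosMul z₁ * cosMul z₁)).fst x := by
          rw [mul_fst_apply z, ← i3, ← mul_fst_apply]
      _ = (1 - z₁ * star z₁).fst (z.fst x) := by rw [← i2]; rfl
  · rintro _ ⟨a, rfl⟩
    refine hk.induction_on (p := fun a => ((cosMul z).fst.prod z.fst) a ∈
      (composite T₁ T₂).graph.topologicalClosure) a
      ((Submodule.isClosed_topologicalClosure _).preimage (ContinuousLinearMap.continuous _))
      fun e => Submodule.le_topologicalClosure _ ?_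
    -- At `k e` the point is `(c₂c₁ e, z₁z₂ e)`, and `z₂c₁ e = c₁z₂ e` lies in the domain of `T₁`.
    refine (mem_graph_composite h₁ h₂).2
      ⟨(cosMul z₁).fst e, z₂.fst e, ?_, act hz₂c.eq e, act hzk e⟩
    exact act (hczk.trans hcc.eq) e

theorem isClosable_of_closure_graph {T : A →ₗ.[ℂ] A} {z : 𝓜(ℂ, A)} (hz : ‖z‖ ≤ 1)
    (hd : DenseRange (cosMul z).fst) (h : T.graph.topologicalClosure = transformGraph z) :
    T.IsClosable :=
  ⟨(transformGraph z).toLinearPMap, by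
    rw [h, (isZTransform_iff_graph.1 (isZTransform_toLinearPMap hz hd)).2]⟩

end CStarAffiliation

/-! ### The main theorem -/

theorem mainTheorem11 {A : Type*} [NonUnitalCStarAlgebra A] (T₁ T₂ : A →ₗ.[ℂ] A)
    (h₁ : CStarAffiliation.IsAffiliated T₁) (h₂ : CStarAffiliation.IsAffiliated T₂)
    (hcomm : CStarAffiliation.StronglyCommute T₁ T₂ h₁ h₂) :
    (CStarAffiliation.composite T₁ T₂).IsClosable ∧
      CStarAffiliation.IsAffiliated (CStarAffiliation.composite T₁ T₂).closure ∧
      (CStarAffiliation.composite T₂ T₁).IsClosable ∧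
      (CStarAffiliation.composite T₁ T₂).closure = (CStarAffiliation.composite T₂ T₁).closure := by
  open CStarAffiliation in
  obtain ⟨h, h'⟩ := hcomm
  have hz₁ := zTransform_spec T₁ h₁
  have hz₂ := zTransform_spec T₂ h₂
  set z₁ := zTransform T₁ h₁
  set z₂ := zTransform T₂ h₂
  replace h : Commute z₁ z₂ := h
  replace h' : Commute (star z₁) z₂ := h'
  have hd₁ := denseRange_cosMul h₁.1 hz₁
  have hd₂ := denseRange_cosMul h₂.1 hz₂
  obtain ⟨z, k, hz, hks, hk, hkc₁, hkc₂, hzk, hczk, hck⟩ :=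
    exists_zTransform_product hz₁.1 hz₂.1 hd₁ hd₂ h h'
  have hs' : Commute (star z₂) z₁ := by simpa using h'.star_star.symm
  have hcc : Commute (cosMul z₁) (cosMul z₂) :=
    commute_cosMul (commute_cosMul h.symm h'.symm).symm
      (commute_cosMul hs' h.star_star.symm).symm
  have hcz : DenseRange (cosMul z).fst :=
    denseRange_of_mul_fst (n := k) (hczk ▸ denseRange_mul_fst hd₁ hd₂)
  have hg₁ := closure_graph_composite hz₁ hz₂ hd₁ h h' hz hcz hks hk hkc₁ hck hzk hczk
  -- The same `z` and `k` serve the other order, because `z₁z₂ = z₂z₁` and `c₁c₂ = c₂c₁`.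
  have hg₂ := closure_graph_composite hz₂ hz₁ hd₂ h.symm hs' hz hcz hks hk hkc₂ hck
    (hzk.trans h.eq) (hczk.trans hcc.eq)
  have hc₁ := isClosable_of_closure_graph hz hcz hg₁
  have hc₂ := isClosable_of_closure_graph hz hcz hg₂
  have hgc₁ := hc₁.graph_closure_eq_closure_graph.symm.trans hg₁
  have hgc₂ := hc₂.graph_closure_eq_closure_graph.symm.trans hg₂
  have hzT : IsZTransform (composite T₁ T₂).closure z := isZTransform_iff_graph.2 ⟨hz, hgc₁⟩
  refine ⟨hc₁, ⟨?_, z, hzT⟩, hc₂, LinearPMap.eq_of_eq_graph (hgc₁.trans hgc₂.symm)⟩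
  refine Dense.mono ?_ hcz
  rintro _ ⟨a, rfl⟩
  exact ((hzT.2 _ _).2 ⟨a, rfl, rfl⟩).1
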